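/- Let $n\ge 0$ be an integer, $[n]=\{1,\dots,n\}$, and equip $\mathbb{R}^n$ with the coordinatewise order. An \emph{alcoved polyhedron} is a set of the form $\{x\in\mathbb{R}^n : x_i\ge M_{ij}+x_j \text{ for all } i,j\in[n]\}$, where $M$ is an $n\times n$ matrix with entries in $\mathbb{R}\cup\{-\infty\}$. An \emph{ambitropical polyhedron} is a nonempty set $C\subseteq\mathbb{R}^n$ that is stable under $x\mapsto (\lambda+x_i)_{i\in[n]}$ for all $\lambda\in\mathbb{R}$, is a lattice in the order induced from $\mathbb{R}^n$ (any two elements of $C$ have a least upper bound in $C$ and a greatest lower bound in $C$), and is a union of finitely many alcoved polyhedra. It is \emph{homogeneous} if $\alpha x\in C$ for all $x\in C$ and all real $\alpha>0$. For $C\subseteq\mathbb{R}^n$ put $\operatorname{Sk}C=C\cap\{0,1\}^n$. A \emph{Weyl cell} is a set of the form $$W^{\mathcal I}=\{x\in\mathbb{R}^n : x_i\le x_j \text{ whenever } i\in I_r,\ j\in I_s,\ r\le s\},$$ where $\mathcal I=(I_1,\dots,I_S)$ is an ordered partition of $[n]$ into nonempty blocks; its dimension is that of its affine hull. A \emph{polyhedral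 fan} is a finite set $\mathcal K$ of polyhedral cones such that every nonempty face of a member of $\mathcal K$ is in $\mathcal K$, and the intersection of any two members of $\mathcal K$ is a face of both; its \emph{support} is the union of its members. \textbf{Theorem.} (a) The map $C\mapsto\operatorname{Sk}C$ is a bijection from the set of homogeneous ambitropical polyhedra of $\mathbb{R}^n$ onto the set of those subsets of $\{0,1\}^n$ that contain the bottom element $(0,\dots,0)$ and the top element $(1,\dots,1)$ and are lattices in the induced order. (b) Let $C$ be a homogeneous ambitropical polyhedron of $\mathbb{R}^n$. The map $W\mapsto W\cap\{0,1\}^n$ is a bijection from the set of Weyl cells included in $C$ onto the set of chains of $\operatorname{Sk}C$ that contain both $(0,\dots,0)$ and $(1,\dots,1)$, and the cardinality of the chain $W\cap\{0,1\}^n$ is equal to $\dim W+1$. Moreover, the set of Weyl cells included in $C$ is a polyhedral fan with support $C$. -/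

import Mathlib

namespace Ambitropical

/-- `C`, with the order induced by the coordinatewise order of `ℝⁿ`, is a lattice:
every two elements have a least upper bound and a greatest lower bound in `C`. -/
def IsLatticeInInducedOrder {n : ℕ} (C : Set (Fin n → ℝ)) : Prop :=
  ∀ x ∈ C, ∀ y ∈ C,
    (∃ z, IsLeast {z | z ∈ C ∧ x ≤ z ∧ y ≤ z} z) ∧
    (∃ z, IsGreatest {z | z ∈ C ∧ z ≤ x ∧ z ≤ y} z)

/-- An additive cone: a set stable by the addition of constant vectors. -/
def IsAdditiveCone {n : ℕ} (C : Set (Fin n → ℝ)) : Prop :=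
  ∀ x ∈ C, ∀ c : ℝ, (fun i => c + x i) ∈ C

/-- An ambitropical cone: a nonempty additive cone that is a lattice in the induced order. -/
structure IsAmbitropicalCone {n : ℕ} (C : Set (Fin n → ℝ)) : Prop where
  nonempty : C.Nonempty
  additive : IsAdditiveCone C
  lattice : IsLatticeInInducedOrder C

/-- The set `{x ∈ ℝⁿ | x i ≥ M i j + x j for all i, j}` attached to a matrix `M` with entries
in `ℝ ∪ {-∞}`. -/
def alcoved {n : ℕ} (M : Matrix (Fin n) (Fin n) (WithBot ℝ)) : Set (Fin n → ℝ) :=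
  {x | ∀ i j, M i j + (x j : WithBot ℝ) ≤ (x i : WithBot ℝ)}

/-- An alcoved polyhedron (for the root system of type `A`). -/
def IsAlcovedPolyhedron {n : ℕ} (P : Set (Fin n → ℝ)) : Prop :=
  ∃ M : Matrix (Fin n) (Fin n) (WithBot ℝ), P = alcoved M

/-- An ambitropical polyhedron: an ambitropical cone that is a finite union of alcoved
polyhedra. -/
structure IsAmbitropicalPolyhedron {n : ℕ} (C : Set (Fin n → ℝ)) : Prop where
  cone : IsAmbitropicalCone C
  finite_union : ∃ F : Set (Set (Fin n → ℝ)),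
    F.Finite ∧ (∀ P ∈ F, IsAlcovedPolyhedron P) ∧ C = ⋃₀ F

/-- A homogeneous ambitropical polyhedron: an ambitropical polyhedron stable by multiplication
by positive scalars. -/
structure IsHomogeneousAmbitropicalPolyhedron {n : ℕ} (C : Set (Fin n → ℝ)) : Prop where
  polyhedron : IsAmbitropicalPolyhedron C
  homogeneous : ∀ a : ℝ, 0 < a → ∀ x ∈ C, a • x ∈ C

/-- The Boolean hypercube `{0,1}ⁿ`, as a subset of `ℝⁿ`. -/
def booleanCube (n : ℕ) : Set (Fin n → ℝ) :=
  {x | ∀ i, x i = 0 ∨ x i = 1}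

/-- The skeleton of `C`: its intersection with `{0,1}ⁿ`. -/
def skeleton {n : ℕ} (C : Set (Fin n → ℝ)) : Set (Fin n → ℝ) :=
  C ∩ booleanCube n

/-- `(I 0, …, I (S - 1))` is an ordered partition of the index set, into `S` nonempty blocks. -/
structure IsOrderedPartition {n S : ℕ} (I : Fin S → Set (Fin n)) : Prop where
  nonempty : ∀ s, (I s).Nonempty
  disjoint : ∀ r s, r ≠ s → Disjoint (I r) (I s)
  cover : ∀ i, ∃ s, i ∈ I s

/-- The set `W^I` of an ordered partition `I`. -/
def weylCell {n S : ℕ} (I : Fin S → Set (Fin n)) : Set (Fin n → ℝ) :=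
  {x | ∀ r s, r ≤ s → ∀ i ∈ I r, ∀ j ∈ I s, x i ≤ x j}

/-- `W` is the Weyl cell of some ordered partition. -/
def IsWeylCell {n : ℕ} (W : Set (Fin n → ℝ)) : Prop :=
  ∃ (S : ℕ) (I : Fin S → Set (Fin n)), IsOrderedPartition I ∧ W = weylCell I

/-- The Weyl cells included in `C`. -/
def weylCellsIn {n : ℕ} (C : Set (Fin n → ℝ)) : Set (Set (Fin n → ℝ)) :=
  {W | IsWeylCell W ∧ W ⊆ C}

/-- The dimension of a nonempty polyhedron: the dimension of its affine hull. -/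
noncomputable def polyDim {n : ℕ} (P : Set (Fin n → ℝ)) : ℕ :=
  Module.finrank ℝ (affineSpan ℝ P).direction

/-- A polyhedron: the intersection of finitely many closed affine half-spaces. -/
def IsPolyhedron {n : ℕ} (P : Set (Fin n → ℝ)) : Prop :=
  ∃ (m : ℕ) (l : Fin m → Module.Dual ℝ (Fin n → ℝ)) (b : Fin m → ℝ),
    P = {x | ∀ k, l k x ≤ b k}

/-- A polyhedral cone, in the sense of convex analysis. -/
structure IsPolyhedralCone {n : ℕ} (P : Set (Fin n → ℝ)) : Prop where
  polyhedron : IsPolyhedron P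
  zero_mem : 0 ∈ P
  smul_mem : ∀ a : ℝ, 0 < a → ∀ x ∈ P, a • x ∈ P

/-- `F` is a (nonempty) face of `P`: the set of points of `P` at which some linear form attains
its maximum over `P`; the zero form shows that `P` is a face of itself. -/
def IsFace {n : ℕ} (P F : Set (Fin n → ℝ)) : Prop :=
  F.Nonempty ∧ ∃ l : Module.Dual ℝ (Fin n → ℝ), F = {x | x ∈ P ∧ ∀ y ∈ P, l y ≤ l x}

/-- A polyhedral fan: a finite polyhedral complex all of whose cells are cones. -/
structure IsPolyhedralFan {n : ℕ} (K : Set (Set (Fin n → ℝ))) : Prop where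
  finite : K.Finite
  cone : ∀ P ∈ K, IsPolyhedralCone P
  face_mem : ∀ P ∈ K, ∀ F, IsFace P F → F ∈ K
  inter_face : ∀ P ∈ K, ∀ Q ∈ K, IsFace P (P ∩ Q) ∧ IsFace Q (P ∩ Q)

end Ambitropical

namespace Ambitropical

open Filter Topology

/-! ### Level sets and cells -/

/-! A vector `x` is encoded by its superlevel indicators `level x t`, a decreasing left-continuous
family of Boolean vectors running from `1` to `0`. The order is compared threshold by threshold;
translations and positive scalings merely move thresholds. Part (a) rests on the identity `levelHull
(skeleton C) = C`: a vector lies in `C` exactly when all its superlevel indicators do.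

One inclusion is `cellOf_subset`. Along large multiples of a point of `C`, the finite constants in
the alcoved inequalities become negligible, so `C` contains every vector monotone in that point, in
particular its superlevel indicators. The other, `levelHull_skeleton`, recovers `x` as a join in `C`
of two-valued vectors. Conversely, the operations of a Boolean lattice, applied at each threshold,
make its hull a lattice (`isLatticeInInducedOrder_levelHull`).

Weyl cells are exactly the sets `cellOf x`. The Boolean points of `cellOf x` are `0` and the
superlevel indicators of `x`: a chain, with one nonzero member per value of `x`, which determines
the cell. Faces of cells are likewise determined by their Boolean points (`apply_level_eq_zero`,
`mem_span_level`), hence are cells. -/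

/-- The indicator of the superlevel set `{i | t ≤ x i}`. -/
noncomputable def level {n : ℕ} (x : Fin n → ℝ) (t : ℝ) : Fin n → ℝ :=
  fun i => if t ≤ x i then 1 else 0

/-- The vectors that are nondecreasing functions of the coordinates of `x`. -/
def cellOf {n : ℕ} (x : Fin n → ℝ) : Set (Fin n → ℝ) :=
  {y | ∀ i j, x i ≤ x j → y i ≤ y j}

/-- The vectors all of whose superlevel sets have their indicator in `L`. -/
def levelHull {n : ℕ} (L : Set (Fin n → ℝ)) : Set (Fin n → ℝ) :=
  {x | ∀ t, level x t ∈ L}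

variable {n : ℕ}

theorem level_mem_booleanCube (x : Fin n → ℝ) (t : ℝ) : level x t ∈ booleanCube n := by
  intro i
  by_cases h : t ≤ x i <;> simp [level, h]

theorem le_level_iff {e x : Fin n → ℝ} {t : ℝ} (he : e ∈ booleanCube n) :
    e ≤ level x t ↔ ∀ i, e i = 1 → t ≤ x i := by
  constructor
  · intro h i hi
    by_contra hc
    have := h i
    simp only [level, hc, if_false, hi] at this
    linarith
  · intro h i
    rcases he i with h0 | h1
    · rw [h0]; simp only [level]; split_ifs <;> norm_num
    · simp [level, h i h1, h1]

theorem level_of_forall_le {x : Fin n → ℝ} {t : ℝ} (h : ∀ i, t ≤ x i) : level x t = 1 := by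
  ext i; simp [level, h i]

theorem level_of_forall_lt {x : Fin n → ℝ} {t : ℝ} (h : ∀ i, x i < t) : level x t = 0 := by
  ext i; simp [level, h i]

theorem level_of_mem_booleanCube {e : Fin n → ℝ} (he : e ∈ booleanCube n) (t : ℝ) :
    level e t = 1 ∨ level e t = e ∨ level e t = 0 := by
  rcases le_or_gt t 0 with h | h
  · left
    refine level_of_forall_le fun i => ?_
    rcases he i with h0 | h0 <;> rw [h0] <;> linarith
  rcases le_or_gt t 1 with h1 | h1
  · right; left
    ext i
    rcases he i with h0 | h0 <;> simp [level, h0, h, h1]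
  · right; right
    refine level_of_forall_lt fun i => ?_
    rcases he i with h0 | h0 <;> rw [h0] <;> linarith

theorem level_mono {x y : Fin n → ℝ} (h : x ≤ y) (t : ℝ) : level x t ≤ level y t := by
  intro i
  have := h i
  by_cases h1 : t ≤ x i
  · simp [level, h1, h1.trans this]
  · simp only [level, h1, if_false]; split_ifs <;> norm_num

theorem level_antitone (x : Fin n → ℝ) {s t : ℝ} (h : s ≤ t) : level x t ≤ level x s := by
  intro i
  by_cases h1 : t ≤ x i
  · simp [level, h1, h.trans h1]
  · simp only [level, h1, if_false]; split_ifs <;> norm_num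

theorem le_of_level_le {x y : Fin n → ℝ} (h : ∀ t, level x t ≤ level y t) : x ≤ y := by
  intro i
  have := h (x i) i
  by_contra hc
  simp only [level, le_refl, if_true, hc, if_false] at this
  linarith

theorem level_add (x : Fin n → ℝ) (c t : ℝ) : level (fun i => c + x i) t = level x (t - c) := by
  ext i
  simp only [level, sub_le_iff_le_add']

theorem level_smul (x : Fin n → ℝ) {a : ℝ} (ha : 0 < a) (t : ℝ) :
    level (a • x) t = level x (t / a) := by
  ext i
  simp only [level, Pi.smul_apply, smul_eq_mul, div_le_iff₀' ha]

/-- The strict superlevel sets of a vector are superlevel sets. -/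
theorem exists_level_eq_lt (x : Fin n → ℝ) (t : ℝ) :
    ∃ s, t < s ∧ ∀ i, s ≤ x i ↔ t < x i := by
  have h : ∀ᶠ s in 𝓝[>] t, ∀ i, t < x i → s ≤ x i := by
    rw [eventually_all]
    intro i
    by_cases hi : t < x i
    · filter_upwards [mem_nhdsWithin_of_mem_nhds (Iio_mem_nhds hi)] with s hs _ using le_of_lt hs
    · exact Eventually.of_forall fun s hs => absurd hs hi
  obtain ⟨s, hs, hts⟩ := (h.and self_mem_nhdsWithin).exists
  exact ⟨s, hts, fun i => ⟨fun h => lt_of_lt_of_le hts h, hs i⟩⟩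

/-- Superlevel sets are constant slightly to the left of any threshold. -/
theorem eventually_level_left (x : Fin n → ℝ) (t : ℝ) :
    ∀ᶠ s in 𝓝[<] t, level x s = level x t := by
  have h : ∀ᶠ s in 𝓝[<] t, ∀ i, x i < t → x i < s := by
    rw [eventually_all]
    intro i
    by_cases hi : x i < t
    · filter_upwards [mem_nhdsWithin_of_mem_nhds (Ioi_mem_nhds hi)] with s hs _ using hs
    · exact Eventually.of_forall fun s hs => absurd hs hi
  filter_upwards [h, self_mem_nhdsWithin] with s hs hst
  ext i
  have : s ≤ x i ↔ t ≤ x i :=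
    ⟨fun h => not_lt.1 fun h' => absurd (hs i h') (not_lt.2 h), fun h => (le_of_lt hst).trans h⟩
  simp only [level, this]

theorem self_mem_cellOf (x : Fin n → ℝ) : x ∈ cellOf x := fun _ _ h => h

theorem const_mem_cellOf (x : Fin n → ℝ) (c : ℝ) : (fun _ => c) ∈ cellOf x := fun _ _ _ => le_rfl

theorem zero_mem_cellOf (x : Fin n → ℝ) : 0 ∈ cellOf x := const_mem_cellOf x 0

theorem one_mem_cellOf (x : Fin n → ℝ) : 1 ∈ cellOf x := const_mem_cellOf x 1

theorem smul_mem_cellOf {x y : Fin n → ℝ} {a : ℝ} (ha : 0 ≤ a) (hy : y ∈ cellOf x) :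
    a • y ∈ cellOf x := fun i j h => mul_le_mul_of_nonneg_left (hy i j h) ha

theorem level_mem_cellOf {x y : Fin n → ℝ} (hy : y ∈ cellOf x) (t : ℝ) :
    level y t ∈ cellOf x := by
  intro i j h
  have := hy i j h
  by_cases h1 : t ≤ y i
  · simp [level, h1, h1.trans this]
  · simp only [level, h1, if_false]; split_ifs <;> norm_num

theorem mem_cellOf_of_level {x y : Fin n → ℝ} (h : ∀ t, level y t ∈ cellOf x) :
    y ∈ cellOf x := by
  intro i j hij
  by_contra hc
  have := h (y i) i j hij
  simp only [level, le_refl, if_true, hc, if_false] at this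
  linarith

theorem levelHull_skeleton_cellOf (x : Fin n → ℝ) : levelHull (skeleton (cellOf x)) = cellOf x := by
  ext y
  exact ⟨fun h => mem_cellOf_of_level fun t => (h t).1,
    fun h t => ⟨level_mem_cellOf h t, level_mem_booleanCube y t⟩⟩

/-- Elements of the skeleton of a cell are trivial or superlevel sets. -/
theorem eq_level_of_mem_skeleton_cellOf {x e : Fin n → ℝ} (he : e ∈ skeleton (cellOf x))
    (h0 : e ≠ 0) : ∃ i, e i = 1 ∧ e = level x (x i) := by
  obtain ⟨hc, hb⟩ := he
  have hne : (Finset.univ.filter fun i => e i = 1).Nonempty := by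
    by_contra hemp
    rw [Finset.not_nonempty_iff_eq_empty, Finset.filter_eq_empty_iff] at hemp
    exact h0 (funext fun i => (hb i).resolve_right (hemp (Finset.mem_univ i)))
  -- The support of `e` is closed upwards for the preorder of `x`, so it is the superlevel set at
  -- its smallest value of `x`.
  obtain ⟨i, hi, hmin⟩ := Finset.exists_min_image _ x hne
  simp only [Finset.mem_filter, Finset.mem_univ, true_and] at hi hmin
  refine ⟨i, hi, funext fun j => ?_⟩
  by_cases hj : x i ≤ x j
  · have := hc i j hj
    rcases hb j with h | h
    · rw [hi, h] at this; linarith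
    · simp [level, hj, h]
  · rcases hb j with h | h
    · simp [level, hj, h]
    · exact absurd (hmin j h) hj

theorem isChain_skeleton_cellOf (x : Fin n → ℝ) : IsChain (· ≤ ·) (skeleton (cellOf x)) := by
  intro e he f hf _
  have nonneg : ∀ g ∈ skeleton (cellOf x), (0 : Fin n → ℝ) ≤ g := fun g hg i => by
    rcases hg.2 i with h | h <;> simp [h]
  by_cases h0 : e = 0
  · exact Or.inl (h0 ▸ nonneg f hf)
  by_cases h1 : f = 0
  · exact Or.inr (h1 ▸ nonneg e he)
  obtain ⟨i, -, rfl⟩ := eq_level_of_mem_skeleton_cellOf he h0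
  obtain ⟨j, -, rfl⟩ := eq_level_of_mem_skeleton_cellOf hf h1
  rcases le_total (x i) (x j) with h | h
  · exact Or.inr (level_antitone x h)
  · exact Or.inl (level_antitone x h)

/-- An ordered partition is a total preorder on the indices: take `x` to be the block number, or
conversely take as blocks the fibres of `x`, in increasing order of value. -/
theorem isWeylCell_iff {W : Set (Fin n → ℝ)} : IsWeylCell W ↔ ∃ x, W = cellOf x := by
  constructor
  · rintro ⟨S, I, hI, rfl⟩
    choose s hs using hI.cover
    have key : ∀ r i, i ∈ I r → s i = r := fun r i hi => by
      by_contra h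
      exact Set.disjoint_left.1 (hI.disjoint _ _ h) (hs i) hi
    refine ⟨fun i => ((s i : ℕ) : ℝ), ?_⟩
    ext y
    constructor
    · intro h i j hij
      exact h (s i) (s j) (by simpa using hij) i (hs i) j (hs j)
    · intro h r t hrt i hi j hj
      refine h i j ?_
      simp only [key r i hi, key t j hj]
      exact_mod_cast hrt
  · rintro ⟨x, rfl⟩
    let e := (Finset.univ.image x).orderIsoOfFin rfl
    refine ⟨_, fun s => {i | x i = e s}, ⟨?_, ?_, ?_⟩, ?_⟩
    · intro s
      obtain ⟨i, -, hi⟩ := Finset.mem_image.1 (e s).2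
      exact ⟨i, hi⟩
    · intro r s hrs
      rw [Set.disjoint_left]
      intro i (hi : x i = _) (hj : x i = _)
      exact hrs (e.injective (Subtype.ext (hi.symm.trans hj)))
    · intro i
      refine ⟨e.symm ⟨x i, Finset.mem_image_of_mem x (Finset.mem_univ i)⟩, ?_⟩
      simp
    · ext y
      constructor
      · intro h r s hrs i (hi : x i = _) j (hj : x j = _)
        exact h i j (by rw [hi, hj]; exact e.monotone hrs)
      · intro h i j hij
        refine h (e.symm ⟨x i, Finset.mem_image_of_mem x (Finset.mem_univ i)⟩)
          (e.symm ⟨x j, Finset.mem_image_of_mem x (Finset.mem_univ j)⟩) ?_ i ?_ j ?_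
        · exact e.symm.monotone hij
        · simp
        · simp

theorem finite_setOf_isWeylCell : {W : Set (Fin n → ℝ) | IsWeylCell W}.Finite := by
  refine (Set.finite_range fun r : Fin n → Fin n → Prop =>
    {y : Fin n → ℝ | ∀ i j, r i j → y i ≤ y j}).subset ?_
  intro W hW
  obtain ⟨x, rfl⟩ := isWeylCell_iff.1 hW
  exact ⟨fun i j => x i ≤ x j, rfl⟩

/-! ### Homogeneous ambitropical polyhedra are unions of cells -/

theorem mem_alcoved_iff {M : Matrix (Fin n) (Fin n) (WithBot ℝ)} {x : Fin n → ℝ} :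
    x ∈ alcoved M ↔ ∀ i j, ∀ m : ℝ, M i j = m → m + x j ≤ x i := by
  refine forall_congr' fun i => forall_congr' fun j => ?_
  cases h : M i j with
  | bot => simp
  | coe m =>
    rw [← WithBot.coe_add, WithBot.coe_le_coe]
    simp

theorem isAlcovedPolyhedron_cellOf (x : Fin n → ℝ) : IsAlcovedPolyhedron (cellOf x) := by
  classical
  refine ⟨Matrix.of fun i j => if x j ≤ x i then ((0 : ℝ) : WithBot ℝ) else ⊥, ?_⟩
  ext y
  simp only [mem_alcoved_iff, Matrix.of_apply]
  constructor
  · intro h i j m hm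
    by_cases hij : x j ≤ x i
    · rw [if_pos hij, WithBot.coe_inj] at hm
      have := h j i hij
      linarith
    · simp [hij] at hm
  · intro h i j hij
    have := h j i 0 (by rw [if_pos hij])
    linarith

theorem isClosed_alcoved (M : Matrix (Fin n) (Fin n) (WithBot ℝ)) : IsClosed (alcoved M) := by
  have : alcoved M = ⋂ i, ⋂ j, ⋂ m : ℝ, ⋂ _ : M i j = m, {x | m + x j ≤ x i} := by
    ext x; simp only [mem_alcoved_iff, Set.mem_iInter, Set.mem_ofPred_eq]
  rw [this]
  exact isClosed_iInter fun i => isClosed_iInter fun j => isClosed_iInter fun m =>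
    isClosed_iInter fun _ => isClosed_le (by fun_prop) (by fun_prop)

theorem IsAmbitropicalPolyhedron.isClosed {C : Set (Fin n → ℝ)}
    (hC : IsAmbitropicalPolyhedron C) : IsClosed C := by
  obtain ⟨F, hF, hP, rfl⟩ := hC.finite_union
  rw [Set.sUnion_eq_biUnion]
  refine hF.isClosed_biUnion fun P h => ?_
  obtain ⟨M, rfl⟩ := hP P h
  exact isClosed_alcoved M

/-- Vectors inducing the same preorder as a point of `C` on the coordinates are in `C`. -/
theorem mem_of_strictMono {C : Set (Fin n → ℝ)} (hC : IsHomogeneousAmbitropicalPolyhedron C)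
    {x y : Fin n → ℝ} (hx : x ∈ C) (hy : y ∈ cellOf x) (hlt : ∀ i j, x i < x j → y i < y j) :
    y ∈ C := by
  have hpos : ∀ k : ℕ, (0 : ℝ) < k + 1 := fun k => by positivity
  obtain ⟨F, hF, hP, hCF⟩ := hC.polyhedron.finite_union
  have hmem : ∀ k : ℕ, ((k : ℝ) + 1) • x ∈ ⋃₀ F := fun k =>
    hCF ▸ hC.homogeneous _ (hpos k) x hx
  -- Pigeonhole: `F` is finite, so a single alcoved piece contains infinitely many of these
  -- multiples of `x`.
  obtain ⟨P, hPF, hfreq⟩ : ∃ P ∈ F, ∃ᶠ k : ℕ in atTop, ((k : ℝ) + 1) • x ∈ P := by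
    by_contra! hcon
    have : ∀ᶠ k : ℕ in atTop, ∀ P ∈ F, ((k : ℝ) + 1) • x ∉ P :=
      (eventually_all_finite hF).2 fun P h => by simpa using hcon P h
    obtain ⟨k, hk⟩ := this.exists
    obtain ⟨P, h, hkP⟩ := hmem k
    exact hk P h hkP
  obtain ⟨M, rfl⟩ := hP P hPF
  have hlim : Tendsto (fun k : ℕ => (k : ℝ) + 1) atTop atTop :=
    tendsto_atTop_add_const_right _ _ tendsto_natCast_atTop_atTop
  have hev : ∀ᶠ k : ℕ in atTop, ((k : ℝ) + 1) • y ∈ alcoved M := by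
    simp only [mem_alcoved_iff, Pi.smul_apply, smul_eq_mul]
    rw [eventually_all]; intro i
    rw [eventually_all]; intro j
    cases h : M i j with
    | bot => simp
    | coe m =>
      simp only [WithBot.coe_inj, forall_eq']
      have hfr : ∃ᶠ k : ℕ in atTop, m ≤ ((k : ℝ) + 1) * (x i - x j) := by
        refine hfreq.mono fun k hk => ?_
        have := mem_alcoved_iff.1 hk i j m h
        simp only [Pi.smul_apply, smul_eq_mul] at this
        linarith
      -- A finite entry `m` is incompatible with `x i < x j`, forces `m ≤ 0` when `x i = x j`, and
      -- is eventually exceeded by the multiples of `y i - y j` when `x j < x i`.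
      rcases lt_trichotomy (x i) (x j) with hij | hij | hij
      · exfalso
        have : Tendsto (fun k : ℕ => ((k : ℝ) + 1) * (x i - x j)) atTop atBot :=
          hlim.atTop_mul_const_of_neg (sub_neg.2 hij)
        obtain ⟨k, hk1, hk2⟩ := (hfr.and_eventually (this.eventually_lt_atBot m)).exists
        linarith
      · obtain ⟨k, hk⟩ := hfr.exists
        have e : y i = y j := le_antisymm (hy i j hij.le) (hy j i hij.ge)
        rw [hij, sub_self, mul_zero] at hk
        refine Eventually.of_forall fun k => ?_
        rw [e]; linarith
      · have : Tendsto (fun k : ℕ => ((k : ℝ) + 1) * (y i - y j)) atTop atTop :=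
          hlim.atTop_mul_const (sub_pos.2 (hlt j i hij))
        filter_upwards [this.eventually_ge_atTop m] with k hk
        linarith
  obtain ⟨k, hk⟩ := hev.exists
  have hkC : ((k : ℝ) + 1) • y ∈ C := hCF ▸ ⟨_, hPF, hk⟩
  have := hC.homogeneous _ (inv_pos.2 (hpos k)) _ hkC
  rwa [smul_smul, inv_mul_cancel₀ (hpos k).ne', one_smul] at this

/-- For small `ε > 0`, `y + ε • x` orders the coordinates strictly as `x` does, so it lies in `C`;
since `C` is closed, let `ε` tend to `0`. -/
theorem cellOf_subset {C : Set (Fin n → ℝ)} (hC : IsHomogeneousAmbitropicalPolyhedron C)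
    {x : Fin n → ℝ} (hx : x ∈ C) : cellOf x ⊆ C := by
  intro y hy
  have hlim : Tendsto (fun k : ℕ => y + (1 / ((k : ℝ) + 1)) • x) atTop (𝓝 (y + (0 : ℝ) • x)) :=
    tendsto_const_nhds.add (tendsto_one_div_add_atTop_nhds_zero_nat.smul tendsto_const_nhds)
  rw [zero_smul, add_zero] at hlim
  refine hC.polyhedron.isClosed.mem_of_tendsto hlim (Eventually.of_forall fun k => ?_)
  have hk : (0 : ℝ) < 1 / ((k : ℝ) + 1) := by positivity
  refine mem_of_strictMono hC hx (fun i j h => ?_) fun i j h => ?_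
  · exact add_le_add (hy i j h) (mul_le_mul_of_nonneg_left h hk.le)
  · exact add_lt_add_of_le_of_lt (hy i j h.le) (mul_lt_mul_of_pos_left h hk)

theorem zero_mem {C : Set (Fin n → ℝ)} (hC : IsHomogeneousAmbitropicalPolyhedron C) : 0 ∈ C :=
  let ⟨x, hx⟩ := hC.polyhedron.cone.nonempty
  cellOf_subset hC hx (zero_mem_cellOf x)

theorem one_mem {C : Set (Fin n → ℝ)} (hC : IsHomogeneousAmbitropicalPolyhedron C) : 1 ∈ C :=
  let ⟨x, hx⟩ := hC.polyhedron.cone.nonempty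
  cellOf_subset hC hx (one_mem_cellOf x)

theorem level_mem {C : Set (Fin n → ℝ)} (hC : IsHomogeneousAmbitropicalPolyhedron C)
    {x : Fin n → ℝ} (hx : x ∈ C) (t : ℝ) : level x t ∈ C :=
  cellOf_subset hC hx (level_mem_cellOf (self_mem_cellOf x) t)

/-- A nonempty finite family in a lattice `C` has an upper bound in `C` lying below every upper
bound in `C`. -/
theorem IsLatticeInInducedOrder.exists_finset_sup {C : Set (Fin n → ℝ)}
    (hC : IsLatticeInInducedOrder C) {ι : Type*} (s : Finset ι) (hs : s.Nonempty)
    (l : ι → Fin n → ℝ) (hl : ∀ i ∈ s, l i ∈ C) :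
    ∃ z ∈ C, (∀ i ∈ s, l i ≤ z) ∧ ∀ u ∈ C, (∀ i ∈ s, l i ≤ u) → z ≤ u := by
  classical
  induction hs using Finset.Nonempty.cons_induction with
  | singleton a => exact ⟨l a, hl a (by simp), by simp, fun u _ h => h a (by simp)⟩
  | cons a s ha hs ih =>
    obtain ⟨z, hz, hub, hleast⟩ := ih fun i hi => hl i (Finset.mem_cons_of_mem hi)
    obtain ⟨w, ⟨hw, haw, hzw⟩, hmin⟩ := (hC (l a) (hl a (Finset.mem_cons_self a s)) z hz).1
    refine ⟨w, hw, ?_, fun u hu h => hmin ⟨hu, h a (Finset.mem_cons_self a s), hleast u hu fun i hi =>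
      h i (Finset.mem_cons_of_mem hi)⟩⟩
    intro i hi
    rcases Finset.mem_cons.1 hi with rfl | hi
    · exact haw
    · exact (hub i hi).trans hzw

/-- A homogeneous ambitropical polyhedron is determined by its skeleton. -/
theorem levelHull_skeleton {C : Set (Fin n → ℝ)} (hC : IsHomogeneousAmbitropicalPolyhedron C) :
    levelHull (skeleton C) = C := by
  refine Set.Subset.antisymm (fun x hx => ?_) fun x hx t =>
    ⟨level_mem hC hx t, level_mem_booleanCube x t⟩
  rcases isEmpty_or_nonempty (Fin n) with hn | hn
  · rw [Subsingleton.elim x 0]; exact zero_mem hC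
  obtain ⟨a, ha⟩ := (Set.finite_range x).bddBelow
  obtain ⟨b, hb⟩ := (Set.finite_range x).bddAbove
  replace ha : ∀ i, a ≤ x i := fun i => ha ⟨i, rfl⟩
  replace hb : ∀ i, x i ≤ b := fun i => hb ⟨i, rfl⟩
  have haff : ∀ c d t : ℝ, 0 ≤ d → (fun i => c + (d • level x t) i) ∈ C := fun c d t hd => by
    refine hC.polyhedron.cone.additive _ ?_ c
    rcases hd.eq_or_lt with rfl | hd
    · rw [zero_smul]; exact zero_mem hC
    · exact hC.homogeneous d hd _ (hx t).1
  -- The `i`-th vector equals `x i` where `x ≥ x i` and `a` elsewhere: it is below `x` and agrees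
  -- with it at `i`. The join in `C` is therefore at least `x`, but could a priori be larger.
  obtain ⟨z, hz, hub, hleast⟩ := hC.polyhedron.cone.lattice.exists_finset_sup Finset.univ
    Finset.univ_nonempty (fun i j => a + ((x i - a) • level x (x i)) j)
    fun i _ => haff _ _ _ (sub_nonneg.2 (ha i))
  have hxz : x ≤ z := fun i => by
    have := hub i (Finset.mem_univ i) i
    simpa [level] using this
  have hzx : z ≤ x := fun i => by
    obtain ⟨s, -, hs⟩ := exists_level_eq_lt x (x i)
    -- This competing upper bound, equal to `x i` where `x ≤ x i` and to `b` elsewhere, lies in `C`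
    -- and forces `z i ≤ x i`.
    have hu : x ≤ fun j => x i + ((b - x i) • level x s) j := fun j => by
      by_cases h : s ≤ x j
      · simp [level, h, hb j]
      · simpa [level, h] using not_lt.1 ((hs j).not.1 h)
    have h := hleast _ (haff (x i) (b - x i) s (sub_nonneg.2 (hb i))) fun j _ => by
      refine le_trans (fun k => ?_) hu
      by_cases h : x j ≤ x k
      · simp [level, h]
      · simp [level, h, ha k]
    have h2 : ¬ s ≤ x i := (hs i).not.2 (lt_irrefl _)
    simpa [level, h2] using h i
  rwa [le_antisymm hxz hzx]

/-- Joins and meets taken in `C` are already Boolean. Rounding the join down to `{z ≥ 1}` keeps it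
an upper bound, and rounding the meet up to `{w > 0}` keeps it a lower bound; extremality leaves no
room for a change. -/
theorem isLatticeInInducedOrder_skeleton {C : Set (Fin n → ℝ)}
    (hC : IsHomogeneousAmbitropicalPolyhedron C) : IsLatticeInInducedOrder (skeleton C) := by
  intro e he f hf
  have nonneg : ∀ g ∈ skeleton C, (0 : Fin n → ℝ) ≤ g := fun g hg i => by
    rcases hg.2 i with h | h <;> simp [h]
  have le_one : ∀ g ∈ skeleton C, g ≤ (1 : Fin n → ℝ) := fun g hg i => by
    rcases hg.2 i with h | h <;> simp [h]
  obtain ⟨⟨z, ⟨hz, hez, hfz⟩, hmin⟩, ⟨w, ⟨hw, hwe, hwf⟩, hmax⟩⟩ :=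
    hC.polyhedron.cone.lattice e he.1 f hf.1
  constructor
  · have hle : z ≤ level z 1 := hmin ⟨level_mem hC hz 1,
      (le_level_iff he.2).2 fun i hi => hi ▸ hez i, (le_level_iff hf.2).2 fun i hi => hi ▸ hfz i⟩
    have hge : level z 1 ≤ z := fun i => by
      by_cases h : 1 ≤ z i
      · simp [level, h]
      · simpa [level, h] using (nonneg e he i).trans (hez i)
    have hzb : z ∈ booleanCube n := le_antisymm hle hge ▸ level_mem_booleanCube z 1
    exact ⟨z, ⟨⟨hz, hzb⟩, hez, hfz⟩, fun u hu => hmin ⟨hu.1.1, hu.2⟩⟩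
  · obtain ⟨s, -, hs⟩ := exists_level_eq_lt w 0
    have key : ∀ g ∈ skeleton C, w ≤ g → level w s ≤ g := fun g hg hwg i => by
      by_cases h : s ≤ w i
      · rcases hg.2 i with h0 | h1
        · have := ((hs i).1 h).trans_le (hwg i)
          rw [h0] at this; exact absurd this (lt_irrefl _)
        · simp [level, h, h1]
      · simpa [level, h] using nonneg g hg i
    have hle : level w s ≤ w := hmax ⟨level_mem hC hw s, key e he hwe, key f hf hwf⟩
    have hge : w ≤ level w s := fun i => by
      by_cases h : s ≤ w i
      · simpa [level, h] using (hwe i).trans (le_one e he i)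
      · simpa [level, h] using not_lt.1 ((hs i).not.1 h)
    have hwb : w ∈ booleanCube n := le_antisymm hle hge ▸ level_mem_booleanCube w s
    exact ⟨w, ⟨⟨hw, hwb⟩, hwe, hwf⟩, fun u hu => hmax ⟨hu.1.1, hu.2⟩⟩

/-! ### The hull of a Boolean lattice -/

/-- A decreasing left-continuous family of Boolean vectors is a family of superlevel sets. -/
theorem exists_forall_level_eq (E : ℝ → Fin n → ℝ) (hE : ∀ t, E t ∈ booleanCube n)
    (hanti : Antitone E) (a b : ℝ) (ha : E a = 1) (hb : E b = 0)
    (hleft : ∀ t, ∃ s < t, E s = E t) : ∃ z, ∀ t, level z t = E t := by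
  have hbdd : ∀ i, BddAbove {t | E t i = 1} := fun i => ⟨b, fun t (ht : E t i = 1) => by
    by_contra hc
    have := hanti (not_le.1 hc).le i
    rw [hb, ht] at this
    exact absurd this (by norm_num)⟩
  refine ⟨fun i => sSup {t | E t i = 1}, fun t => funext fun i => ?_⟩
  -- `hleft` is left-continuity: it puts the supremum itself in the set.
  have key : t ≤ sSup {t | E t i = 1} ↔ E t i = 1 := by
    constructor
    · intro h
      obtain ⟨s, hst, hs⟩ := hleft t
      obtain ⟨u, hu : E u i = 1, hsu⟩ := exists_lt_of_lt_csSup ⟨a, by simp [ha]⟩ (hst.trans_le h)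
      have := hanti hsu.le i
      rw [hs, hu] at this
      rcases hE t i with h0 | h1
      · rw [h0] at this; exact absurd this (by norm_num)
      · exact h1
    · exact fun h => le_csSup (hbdd i) h
  rcases hE t i with h0 | h1
  · have : ¬ t ≤ sSup {t | E t i = 1} := by rw [key, h0]; norm_num
    simp only [level, this, if_false, h0]
  · simp only [level, key.2 h1, if_true, h1]

/-- A monotone idempotent operation on a set of Boolean vectors extends to its hull. -/
theorem exists_levelHull_operation {L : Set (Fin n → ℝ)} (hL : L ⊆ booleanCube n)
    (m : L → L → L) (hm : ∀ e e' f f', e ≤ e' → f ≤ f' → m e f ≤ m e' f')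
    (hid : ∀ e, m e e = e) {x y : Fin n → ℝ} (hx : x ∈ levelHull L) (hy : y ∈ levelHull L) :
    ∃ z : Fin n → ℝ, ∀ t, level z t = ↑(m ⟨level x t, hx t⟩ ⟨level y t, hy t⟩ : L) := by
  have hev : ∀ᶠ t : ℝ in atBot, (∀ i, t ≤ x i) ∧ ∀ i, t ≤ y i :=
    (eventually_all.2 fun i => eventually_le_atBot _).and
      (eventually_all.2 fun i => eventually_le_atBot _)
  obtain ⟨a, hax, hay⟩ := hev.exists
  have hev' : ∀ᶠ t : ℝ in atTop, (∀ i, x i < t) ∧ ∀ i, y i < t :=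
    (eventually_all.2 fun i => eventually_gt_atTop _).and
      (eventually_all.2 fun i => eventually_gt_atTop _)
  obtain ⟨b, hbx, hby⟩ := hev'.exists
  -- Idempotence serves only at the extreme thresholds, where both arguments are `1` or both are
  -- `0`.
  refine exists_forall_level_eq (fun t => (m ⟨level x t, hx t⟩ ⟨level y t, hy t⟩ : Fin n → ℝ)) (fun t => hL (m _ _).2)
    (fun s t hst => hm _ _ _ _ (level_antitone x hst) (level_antitone y hst)) a b ?_ ?_ fun t => ?_
  · simp only [level_of_forall_le hax, level_of_forall_le hay, hid]
  · simp only [level_of_forall_lt hbx, level_of_forall_lt hby, hid]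
  · obtain ⟨s, ⟨hsx, hsy⟩, hst⟩ := (((eventually_level_left x t).and
      (eventually_level_left y t)).and self_mem_nhdsWithin).exists
    exact ⟨s, hst, by simp only [hsx, hsy]⟩

/-- The join and meet of `L` are monotone and idempotent, so applying them at each threshold gives
the superlevel family of a vector; the universal properties hold level by level. -/
theorem isLatticeInInducedOrder_levelHull {L : Set (Fin n → ℝ)} (hL : L ⊆ booleanCube n)
    (hlat : IsLatticeInInducedOrder L) :
    IsLatticeInInducedOrder (levelHull L) := by
  choose s hs using fun e f : L => (hlat e e.2 f f.2).1
  choose p hp using fun e f : L => (hlat e e.2 f f.2).2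
  intro x hx y hy
  constructor
  · obtain ⟨z, hz⟩ := exists_levelHull_operation hL (fun e f => ⟨s e f, (hs e f).1.1⟩)
      (fun e e' f f' he hf => (hs e f).2 ⟨(hs e' f').1.1, le_trans he (hs e' f').1.2.1,
        le_trans hf (hs e' f').1.2.2⟩)
      (fun e => Subtype.ext (le_antisymm ((hs e e).2 ⟨e.2, le_rfl, le_rfl⟩) (hs e e).1.2.1)) hx hy
    refine ⟨z, ⟨fun t => hz t ▸ Subtype.coe_prop _, le_of_level_le fun t => ?_,
      le_of_level_le fun t => ?_⟩, fun w ⟨hw, hxw, hyw⟩ => le_of_level_le fun t => ?_⟩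
    · rw [hz]; exact (hs ⟨level x t, hx t⟩ ⟨level y t, hy t⟩).1.2.1
    · rw [hz]; exact (hs ⟨level x t, hx t⟩ ⟨level y t, hy t⟩).1.2.2
    · rw [hz]; exact (hs _ _).2 ⟨hw t, level_mono hxw t, level_mono hyw t⟩
  · obtain ⟨z, hz⟩ := exists_levelHull_operation hL (fun e f => ⟨p e f, (hp e f).1.1⟩)
      (fun e e' f f' he hf => (hp e' f').2 ⟨(hp e f).1.1, le_trans (hp e f).1.2.1 he,
        le_trans (hp e f).1.2.2 hf⟩)
      (fun e => Subtype.ext (le_antisymm (hp e e).1.2.1 ((hp e e).2 ⟨e.2, le_rfl, le_rfl⟩))) hx hy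
    refine ⟨z, ⟨fun t => hz t ▸ Subtype.coe_prop _, le_of_level_le fun t => ?_,
      le_of_level_le fun t => ?_⟩, fun w ⟨hw, hxw, hyw⟩ => le_of_level_le fun t => ?_⟩
    · rw [hz]; exact (hp ⟨level x t, hx t⟩ ⟨level y t, hy t⟩).1.2.1
    · rw [hz]; exact (hp ⟨level x t, hx t⟩ ⟨level y t, hy t⟩).1.2.2
    · rw [hz]; exact (hp _ _).2 ⟨hw t, level_mono hxw t, level_mono hyw t⟩

theorem level_zero_mem {L : Set (Fin n → ℝ)} (h0 : 0 ∈ L) (h1 : 1 ∈ L) (t : ℝ) :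
    level (0 : Fin n → ℝ) t ∈ L := by
  rcases level_of_mem_booleanCube (e := (0 : Fin n → ℝ)) (fun i => Or.inl rfl) t with h | h | h <;>
    rw [h] <;> assumption

/-- Superlevel sets of an element of `cellOf x` are trivial or superlevel sets of `x`. -/
theorem cellOf_subset_levelHull {L : Set (Fin n → ℝ)} (h0 : 0 ∈ L) {x : Fin n → ℝ}
    (hx : x ∈ levelHull L) : cellOf x ⊆ levelHull L := by
  intro y hy t
  by_cases h : level y t = 0
  · rwa [h]
  · obtain ⟨i, -, hi⟩ := eq_level_of_mem_skeleton_cellOf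
      ⟨level_mem_cellOf hy t, level_mem_booleanCube y t⟩ h
    exact hi ▸ hx _

theorem sUnion_weylCellsIn {C : Set (Fin n → ℝ)} (h : ∀ x ∈ C, cellOf x ⊆ C) :
    ⋃₀ weylCellsIn C = C :=
  Set.Subset.antisymm (Set.sUnion_subset fun _ hW => hW.2) fun x hx =>
    ⟨cellOf x, ⟨isWeylCell_iff.2 ⟨x, rfl⟩, h x hx⟩, self_mem_cellOf x⟩

theorem isHomogeneousAmbitropicalPolyhedron_levelHull {L : Set (Fin n → ℝ)}
    (hL : L ⊆ booleanCube n) (h0 : 0 ∈ L) (h1 : 1 ∈ L) (hlat : IsLatticeInInducedOrder L) :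
    IsHomogeneousAmbitropicalPolyhedron (levelHull L) where
  polyhedron :=
    { cone :=
        { nonempty := ⟨0, level_zero_mem h0 h1⟩
          additive := fun x hx c t => level_add x c t ▸ hx _
          lattice := isLatticeInInducedOrder_levelHull hL hlat }
      finite_union := ⟨weylCellsIn (levelHull L),
        finite_setOf_isWeylCell.subset fun _ hW => hW.1,
        fun W hW => by
          obtain ⟨x, rfl⟩ := isWeylCell_iff.1 hW.1
          exact isAlcovedPolyhedron_cellOf x,
        (sUnion_weylCellsIn fun x hx => cellOf_subset_levelHull h0 hx).symm⟩ }
  homogeneous := fun a ha x hx t => level_smul x ha t ▸ hx _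

theorem skeleton_levelHull {L : Set (Fin n → ℝ)} (hL : L ⊆ booleanCube n) (h0 : 0 ∈ L)
    (h1 : 1 ∈ L) : skeleton (levelHull L) = L := by
  ext e
  constructor
  · rintro ⟨he, hb⟩
    have : level e 1 = e := by
      ext i
      rcases hb i with h | h <;> simp [level, h]
    exact this ▸ he 1
  · intro he
    refine ⟨fun t => ?_, hL he⟩
    rcases level_of_mem_booleanCube (hL he) t with h | h | h <;> rw [h] <;> assumption

theorem zero_mem_booleanCube : (0 : Fin n → ℝ) ∈ booleanCube n := fun _ => Or.inl rfl

theorem one_mem_booleanCube : (1 : Fin n → ℝ) ∈ booleanCube n := fun _ => Or.inr rfl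

theorem bijOn_skeleton : Set.BijOn (fun C : Set (Fin n → ℝ) => skeleton C)
    {C | IsHomogeneousAmbitropicalPolyhedron C}
    {L | L ⊆ booleanCube n ∧ 0 ∈ L ∧ 1 ∈ L ∧ IsLatticeInInducedOrder L} := by
  refine ⟨fun C hC => ⟨Set.inter_subset_right, ⟨zero_mem hC, zero_mem_booleanCube⟩,
    ⟨one_mem hC, one_mem_booleanCube⟩, isLatticeInInducedOrder_skeleton hC⟩,
    fun C hC D hD h => ?_, fun L ⟨hL, h0, h1, hlat⟩ => ?_⟩
  · rw [← levelHull_skeleton hC, ← levelHull_skeleton hD]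
    exact congrArg levelHull h
  · exact ⟨levelHull L, isHomogeneousAmbitropicalPolyhedron_levelHull hL h0 h1 hlat,
      skeleton_levelHull hL h0 h1⟩

/-! ### Cells and chains -/

theorem finite_booleanCube : (booleanCube n).Finite := by
  refine (Set.Finite.pi' fun _ : Fin n => Set.toFinite ({0, 1} : Set ℝ)).subset fun x hx i => ?_
  simpa using hx i

/-- Every chain of Boolean vectors with bottom and top is the skeleton of a cell. -/
theorem exists_skeleton_cellOf_eq {K : Set (Fin n → ℝ)} (hK : K ⊆ booleanCube n) (h0 : 0 ∈ K)
    (h1 : 1 ∈ K) (hchain : IsChain (· ≤ ·) K) : ∃ x, skeleton (cellOf x) = K := by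
  have hfin : K.Finite := finite_booleanCube.subset hK
  -- `x i` counts the members of the chain whose support contains `i`. As supports are nested, two
  -- members cannot separate `i` from `j` in opposite directions, so this count recovers the
  -- preorder common to the chain.
  let x : Fin n → ℝ := ∑ k ∈ hfin.toFinset, k
  have hle : ∀ i j, (∀ k ∈ K, k i ≤ k j) → x i ≤ x j := fun i j h => by
    simp only [x, Finset.sum_apply]
    exact Finset.sum_le_sum fun k hk => h k (hfin.mem_toFinset.1 hk)
  have hle' : ∀ i j, x i ≤ x j → ∀ k ∈ K, k i ≤ k j := fun i j h k hk => by
    by_contra hc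
    have hki : k i = 1 := (hK hk i).resolve_left fun h0 => by
      rcases hK hk j with h' | h' <;> rw [h0, h'] at hc <;> norm_num at hc
    have hkj : k j = 0 := (hK hk j).resolve_right fun h0 => by
      rw [h0, hki] at hc; norm_num at hc
    have hall : ∀ k' ∈ K, k' j ≤ k' i := fun k' hk' => by
      rcases hchain.total hk hk' with h' | h'
      · have := h' i
        rcases hK hk' j with h2 | h2 <;> rw [h2] <;> linarith
      · have := h' j
        rcases hK hk' i with h2 | h2 <;> rw [h2] <;> linarith
    have : x j < x i := by
      simp only [x, Finset.sum_apply]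
      exact Finset.sum_lt_sum (fun k' hk' => hall k' (hfin.mem_toFinset.1 hk'))
        ⟨k, hfin.mem_toFinset.2 hk, not_le.1 hc⟩
    linarith
  refine ⟨x, Set.Subset.antisymm (fun y hy => ?_) fun k hk => ⟨fun i j h => hle' i j h k hk, hK hk⟩⟩
  by_cases hy0 : y = 0
  · rwa [hy0]
  obtain ⟨i, hi, hyx⟩ := eq_level_of_mem_skeleton_cellOf hy hy0
  have hKi : {k | k ∈ K ∧ k i = 1}.Finite := hfin.subset fun k hk => hk.1
  -- The superlevel set of `x` at `x i` is the smallest member of the chain containing `i`.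
  obtain ⟨k, ⟨hk, hki⟩, hmin⟩ := hKi.exists_minimal ⟨1, h1, rfl⟩
  have hkle : ∀ k' ∈ K, k' i = 1 → k ≤ k' := fun k' hk' h => by
    rcases hchain.total hk hk' with h' | h'
    · exact h'
    · exact hmin ⟨hk', h⟩ h'
  suffices y = k by rwa [this]
  rw [hyx]
  ext j
  by_cases hj : x i ≤ x j
  · have := hle' i j hj k hk
    rcases hK hk j with h | h
    · rw [hki, h] at this; norm_num at this
    · simp [level, hj, h]
  · rcases hK hk j with h | h
    · simp [level, hj, h]
    · refine absurd (hle i j fun k' hk' => ?_) hj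
      rcases hK hk' i with h' | h'
      · rw [h']; rcases hK hk' j with h2 | h2 <;> rw [h2]; norm_num
      · rw [h', ← h]; exact hkle k' hk' h' j

theorem bijOn_skeleton_weylCellsIn {C : Set (Fin n → ℝ)}
    (hC : IsHomogeneousAmbitropicalPolyhedron C) :
    Set.BijOn (fun W : Set (Fin n → ℝ) => skeleton W) (weylCellsIn C)
      {K | K ⊆ skeleton C ∧ 0 ∈ K ∧ 1 ∈ K ∧ IsChain (· ≤ ·) K} := by
  refine ⟨?_, ?_, ?_⟩
  · rintro W ⟨hW, hWC⟩
    obtain ⟨x, rfl⟩ := isWeylCell_iff.1 hW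
    exact ⟨Set.inter_subset_inter_left _ hWC, ⟨zero_mem_cellOf x, zero_mem_booleanCube⟩,
      ⟨one_mem_cellOf x, one_mem_booleanCube⟩, isChain_skeleton_cellOf x⟩
  · rintro W ⟨hW, -⟩ V ⟨hV, -⟩ h
    obtain ⟨x, rfl⟩ := isWeylCell_iff.1 hW
    obtain ⟨y, rfl⟩ := isWeylCell_iff.1 hV
    rw [← levelHull_skeleton_cellOf x, ← levelHull_skeleton_cellOf y]
    exact congrArg levelHull h
  · rintro K ⟨hK, h0, h1, hchain⟩
    obtain ⟨x, rfl⟩ := exists_skeleton_cellOf_eq (hK.trans Set.inter_subset_right) h0 h1 hchain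
    refine ⟨cellOf x, ⟨isWeylCell_iff.2 ⟨x, rfl⟩, ?_⟩, rfl⟩
    rw [← levelHull_skeleton_cellOf x, ← levelHull_skeleton hC]
    exact fun y hy t => hK (hy t)

/-! ### Dimension -/

/-- A vector that is a function of `x` is a combination of superlevel sets of `x`. -/
theorem mem_span_level {x y : Fin n → ℝ} (h : ∀ i j, x i = x j → y i = y j) :
    y ∈ Submodule.span ℝ (Set.range (level x)) := by
  classical
  choose s hs hsx using exists_level_eq_lt x
  obtain ⟨g, rfl⟩ : ∃ g : ℝ → ℝ, y = g ∘ x := by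
    have : Function.FactorsThrough y x := fun i j hij => h i j hij
    exact ⟨Function.extend x y 0, (this.extend_comp (e' := (0 : ℝ → ℝ))).symm⟩
  -- Since `level x (s v)` is the indicator of `{x > v}`, each difference is the indicator of the
  -- fibre `{x = v}`.
  have : g ∘ x = ∑ v ∈ Finset.univ.image x, g v • (level x v - level x (s v)) := by
    ext i
    rw [Finset.sum_apply, Finset.sum_eq_single (x i)]
    · simp [level, hsx]
    · intro v _ hv
      rcases lt_or_gt_of_ne hv with h | h
      · simp [level, hsx, h, h.le]
      · simp [level, hsx, not_lt.2 h.le, not_le.2 h]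
    · intro h
      exact absurd (Finset.mem_image_of_mem x (Finset.mem_univ i)) h
  rw [this]
  exact Submodule.sum_mem _ fun v _ => Submodule.smul_mem _ _ (Submodule.sub_mem _
    (Submodule.subset_span ⟨_, rfl⟩) (Submodule.subset_span ⟨_, rfl⟩))

/-- The cell contains `0` and all superlevel indicators of `x`, so its affine hull is the space of
vectors factoring through `x`, with one degree of freedom per value. -/
theorem polyDim_cellOf (x : Fin n → ℝ) : polyDim (cellOf x) = (Set.range x).ncard := by
  have hfac : ∀ y : Fin n → ℝ, (∀ i j, x i = x j → y i = y j) →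
      y ∈ LinearMap.range (LinearMap.funLeft ℝ ℝ (Set.rangeFactorization x)) := fun y hy => by
    refine ⟨fun v => y v.2.choose, funext fun i => ?_⟩
    exact hy _ _ (Set.mem_range_self (f := x) i).choose_spec
  have hspan : vectorSpan ℝ (cellOf x) =
      LinearMap.range (LinearMap.funLeft ℝ ℝ (Set.rangeFactorization x)) := by
    rw [vectorSpan_eq_span_vsub_set_right ℝ (zero_mem_cellOf x)]
    simp only [vsub_eq_sub, sub_zero, Set.image_id']
    refine le_antisymm (Submodule.span_le.2 fun y hy => hfac y fun i j hij =>
      le_antisymm (hy i j hij.le) (hy j i hij.ge)) ?_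
    rintro _ ⟨g, rfl⟩
    refine Submodule.span_mono ?_ (mem_span_level (x := x) fun i j hij => ?_)
    · rintro _ ⟨t, rfl⟩
      exact level_mem_cellOf (self_mem_cellOf x) t
    · exact congrArg g (Subtype.ext hij)
  have hfin : Fintype (Set.range x) := Fintype.ofFinite _
  rw [polyDim, direction_affineSpan, hspan, LinearMap.finrank_range_of_inj
    (LinearMap.funLeft_injective_of_surjective ℝ ℝ _ Set.rangeFactorization_surjective),
    Module.finrank_fintype_fun_eq_card, ← Nat.card_eq_fintype_card, Nat.card_coe_set_eq]

/-- Distinct values of `x` have distinct nonempty superlevel sets; the extra `1` counts the bottom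
element. -/
theorem ncard_skeleton_cellOf (x : Fin n → ℝ) :
    (skeleton (cellOf x)).ncard = (Set.range x).ncard + 1 := by
  have heq : skeleton (cellOf x) = insert 0 (level x '' Set.range x) := by
    ext e
    constructor
    · intro he
      by_cases h : e = 0
      · exact Or.inl h
      · obtain ⟨i, -, hi⟩ := eq_level_of_mem_skeleton_cellOf he h
        exact Or.inr ⟨x i, ⟨i, rfl⟩, hi.symm⟩
    · rintro (rfl | ⟨t, -, rfl⟩)
      · exact ⟨zero_mem_cellOf x, zero_mem_booleanCube⟩
      · exact ⟨level_mem_cellOf (self_mem_cellOf x) t, level_mem_booleanCube x t⟩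
  have hinj : Set.InjOn (level x) (Set.range x) := by
    have key : ∀ i j, level x (x i) = level x (x j) → x j ≤ x i := fun i j h => by
      by_contra hc
      have := congrFun h i
      simp [level, hc] at this
    rintro _ ⟨i, rfl⟩ _ ⟨j, rfl⟩ h
    exact le_antisymm (key j i h.symm) (key i j h)
  rw [heq, Set.ncard_insert_of_notMem, hinj.ncard_image]
  rintro ⟨_, ⟨i, rfl⟩, hi⟩
  have := congrFun hi i
  simp [level] at this

/-! ### The fan of cells -/

theorem isPolyhedralCone_cellOf (x : Fin n → ℝ) : IsPolyhedralCone (cellOf x) where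
  polyhedron := by
    classical
    let e : Fin (n * n) ≃ Fin n × Fin n := finProdFinEquiv.symm
    refine ⟨n * n, fun k => if x (e k).1 ≤ x (e k).2 then
      (LinearMap.proj (R := ℝ) (φ := fun _ => ℝ) (e k).1 - LinearMap.proj (e k).2) else 0, 0, ?_⟩
    ext y
    constructor
    · intro h k
      dsimp only
      split_ifs with hk
      · simpa using h _ _ hk
      · simp
    · intro h i j hij
      have := h (e.symm (i, j))
      simpa [hij] using this
  zero_mem := zero_mem_cellOf x
  smul_mem := fun _ ha _ hy => smul_mem_cellOf ha.le hy

/-- A linear form that is nonpositive on a cell and vanishes at one of its points vanishes at the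
superlevel sets of this point. -/
theorem apply_level_eq_zero {x y : Fin n → ℝ} {l : Module.Dual ℝ (Fin n → ℝ)}
    (hl : ∀ z ∈ cellOf x, l z ≤ 0) (hy : y ∈ cellOf x) (hly : l y = 0) (t : ℝ) :
    l (level y t) = 0 := by
  refine le_antisymm (hl _ (level_mem_cellOf hy t)) ?_
  obtain ⟨s, hs, hst⟩ := ((eventually_level_left y t).and self_mem_nhdsWithin).exists
  replace hst : s < t := hst
  -- No coordinate of `y` lies in `[s, t)`, so lowering those at or above `t` by `t - s` reverses no
  -- inequality. Evaluating `l` there bounds `l (level y t)` from below.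
  have hmem : y - (t - s) • level y t ∈ cellOf x := by
    intro i j hij
    have hyij := hy i j hij
    have hsi : s ≤ y i ↔ t ≤ y i := by
      have := congrFun hs i
      by_cases h1 : s ≤ y i <;> by_cases h2 : t ≤ y i <;> simp [level, h1, h2] at this ⊢
    simp only [Pi.sub_apply, Pi.smul_apply, smul_eq_mul, level]
    by_cases h1 : t ≤ y i
    · simp [h1, h1.trans hyij, hyij]
    · have h3 := not_le.1 (hsi.not.2 h1)
      by_cases h2 : t ≤ y j
      · simp only [h1, h2, if_true, if_false]; linarith
      · simp only [h1, h2, if_false]; linarith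
  have := hl _ hmem
  rw [map_sub, map_smul, hly, smul_eq_mul, zero_sub, neg_nonpos] at this
  exact nonneg_of_mul_nonneg_right this (sub_pos.2 hst)

/-- The maximum of `l` on the cone is `0`, so the face is the zero set of `l` in it. Its Boolean
points form a chain with bottom and top, hence the skeleton of a cell. A vector lies in the face
exactly when its superlevel indicators do, so the two sets coincide. -/
theorem isWeylCell_of_isFace_cellOf {x : Fin n → ℝ} {F : Set (Fin n → ℝ)}
    (hF : IsFace (cellOf x) F) : IsWeylCell F := by
  obtain ⟨⟨y, hy⟩, l, rfl⟩ := hF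
  have hl : ∀ z ∈ cellOf x, l z ≤ 0 := fun z hz => by
    have h0 := hy.2 0 (zero_mem_cellOf x)
    have h2 := hy.2 _ (smul_mem_cellOf zero_le_two hy.1)
    have := hy.2 z hz
    simp only [map_zero, map_smul, smul_eq_mul] at h0 h2
    linarith
  have hface : {z | z ∈ cellOf x ∧ ∀ y ∈ cellOf x, l y ≤ l z} = {z | z ∈ cellOf x ∧ l z = 0} := by
    ext z
    refine and_congr_right fun hz => ⟨fun h => ?_, fun h w hw => h ▸ hl w hw⟩
    exact le_antisymm (hl z hz) (by simpa using h 0 (zero_mem_cellOf x))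
  rw [hface]
  have hone : l 1 = 0 := by
    refine le_antisymm (hl 1 (one_mem_cellOf x)) ?_
    -- The cell contains the whole line of constant vectors.
    have := hl (-1) (const_mem_cellOf x (-1))
    rw [map_neg] at this
    linarith
  obtain ⟨w, hw⟩ := exists_skeleton_cellOf_eq
    (K := skeleton {z | z ∈ cellOf x ∧ l z = 0}) Set.inter_subset_right
    ⟨⟨zero_mem_cellOf x, map_zero l⟩, zero_mem_booleanCube⟩
    ⟨⟨one_mem_cellOf x, hone⟩, one_mem_booleanCube⟩
    ((isChain_skeleton_cellOf x).mono (Set.inter_subset_inter_left _ fun z hz => hz.1))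
  refine isWeylCell_iff.2 ⟨w, ?_⟩
  rw [← levelHull_skeleton_cellOf w, hw]
  ext z
  constructor
  · rintro ⟨hz, hlz⟩ t
    exact ⟨⟨level_mem_cellOf hz t, apply_level_eq_zero hl hz hlz t⟩, level_mem_booleanCube z t⟩
  · intro hz
    refine ⟨mem_cellOf_of_level fun t => (hz t).1.1, ?_⟩
    have hspan : Submodule.span ℝ (Set.range (level z)) ≤ LinearMap.ker l := by
      rw [Submodule.span_le]
      rintro _ ⟨t, rfl⟩
      exact (hz t).1.2
    exact hspan (mem_span_level fun i j (h : z i = z j) => h)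

/-- The form adds `z i - z j` over the pairs ordered one way by `x` and the opposite way by `y`,
ties included. On `cellOf x` each term is nonpositive, and all vanish exactly when `z` also respects
the preorder of `y`. -/
theorem isFace_cellOf_inter (x y : Fin n → ℝ) : IsFace (cellOf x) (cellOf x ∩ cellOf y) := by
  classical
  refine ⟨⟨0, zero_mem_cellOf x, zero_mem_cellOf y⟩,
    ∑ p ∈ Finset.univ.filter fun p : Fin n × Fin n => x p.1 ≤ x p.2 ∧ y p.2 ≤ y p.1,
      (LinearMap.proj (R := ℝ) (φ := fun _ => ℝ) p.1 - LinearMap.proj p.2), ?_⟩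
  ext z
  simp only [LinearMap.sum_apply, LinearMap.sub_apply, LinearMap.proj_apply]
  constructor
  · rintro ⟨hx, hy⟩
    refine ⟨hx, fun w hw => ?_⟩
    rw [Finset.sum_eq_zero (f := fun p : Fin n × Fin n => z p.1 - z p.2)]
    · refine Finset.sum_nonpos fun p hp => ?_
      exact sub_nonpos.2 (hw _ _ (Finset.mem_filter.1 hp).2.1)
    · intro p hp
      obtain ⟨-, h1, h2⟩ := Finset.mem_filter.1 hp
      exact sub_eq_zero.2 (le_antisymm (hx _ _ h1) (hy _ _ h2))
  · rintro ⟨hx, hmax⟩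
    have h0 := hmax 0 (zero_mem_cellOf x)
    simp only [Pi.zero_apply, sub_zero, Finset.sum_const_zero] at h0
    have hnonpos : ∀ p ∈ Finset.univ.filter fun p : Fin n × Fin n => x p.1 ≤ x p.2 ∧ y p.2 ≤ y p.1,
        z p.1 - z p.2 ≤ 0 := fun p hp => sub_nonpos.2 (hx _ _ (Finset.mem_filter.1 hp).2.1)
    have hzero := (Finset.sum_eq_zero_iff_of_nonpos hnonpos).1
      (le_antisymm (Finset.sum_nonpos hnonpos) h0)
    refine ⟨hx, fun i j hij => ?_⟩
    rcases le_total (x i) (x j) with h | h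
    · exact hx i j h
    · have := hzero (j, i) (Finset.mem_filter.2 ⟨Finset.mem_univ _, h, hij⟩)
      exact (sub_eq_zero.1 this).ge

theorem isPolyhedralFan_weylCellsIn (C : Set (Fin n → ℝ)) : IsPolyhedralFan (weylCellsIn C) where
  finite := finite_setOf_isWeylCell.subset fun _ hW => hW.1
  cone := fun W hW => by
    obtain ⟨x, rfl⟩ := isWeylCell_iff.1 hW.1
    exact isPolyhedralCone_cellOf x
  face_mem := fun W hW F hF => by
    obtain ⟨x, rfl⟩ := isWeylCell_iff.1 hW.1
    refine ⟨isWeylCell_of_isFace_cellOf hF, Set.Subset.trans ?_ hW.2⟩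
    obtain ⟨-, l, rfl⟩ := hF
    exact fun z hz => hz.1
  inter_face := fun W hW V hV => by
    obtain ⟨x, rfl⟩ := isWeylCell_iff.1 hW.1
    obtain ⟨y, rfl⟩ := isWeylCell_iff.1 hV.1
    exact ⟨isFace_cellOf_inter x y, Set.inter_comm (cellOf y) _ ▸ isFace_cellOf_inter y x⟩

end Ambitropical

theorem mainTheorem8 (n : ℕ) :
    Set.BijOn (fun C : Set (Fin n → ℝ) => Ambitropical.skeleton C)
      {C | Ambitropical.IsHomogeneousAmbitropicalPolyhedron C}
      {L | L ⊆ Ambitropical.booleanCube n ∧ 0 ∈ L ∧ 1 ∈ L ∧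
        Ambitropical.IsLatticeInInducedOrder L} ∧
    ∀ C : Set (Fin n → ℝ), Ambitropical.IsHomogeneousAmbitropicalPolyhedron C →
      Set.BijOn (fun W : Set (Fin n → ℝ) => Ambitropical.skeleton W)
        (Ambitropical.weylCellsIn C)
        {K | K ⊆ Ambitropical.skeleton C ∧ 0 ∈ K ∧ 1 ∈ K ∧ IsChain (· ≤ ·) K} ∧
      (∀ W ∈ Ambitropical.weylCellsIn C,
        (Ambitropical.skeleton W).ncard = Ambitropical.polyDim W + 1) ∧
      Ambitropical.IsPolyhedralFan (Ambitropical.weylCellsIn C) ∧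
      ⋃₀ Ambitropical.weylCellsIn C = C := by
  refine ⟨Ambitropical.bijOn_skeleton, fun C hC =>
    ⟨Ambitropical.bijOn_skeleton_weylCellsIn hC, fun W hW => ?_,
      Ambitropical.isPolyhedralFan_weylCellsIn C,
      Ambitropical.sUnion_weylCellsIn fun _ hx => Ambitropical.cellOf_subset hC hx⟩⟩
  obtain ⟨x, rfl⟩ := Ambitropical.isWeylCell_iff.1 hW.1
  rw [Ambitropical.ncard_skeleton_cellOf, Ambitropical.polyDim_cellOf]
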